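/- For $\ell,m\in\mathbb{Z}_{\ge 0}$ let \[ \begin{bmatrix}\ell+m\\ m\end{bmatrix}=\prod_{i=1}^{m}\frac{1-q^{\ell+i}}{1-q^{i}}=\sum_{k=0}^{\ell m}p_k(\ell,m)\,q^k \] be the Gaussian polynomial ($q$-binomial coefficient). Let $p(k)$ denote the number of integer partitions of $k$ (so $p(0)=1$), and for $d\in\mathbb{N}$ let $L(d)$ be the smallest integer $k\ge 0$ with $p(k+1)-p(k)\ge d$. Call $\begin{bmatrix}\ell+m\\ m\end{bmatrix}$ $d$-strictly unimodal if $p_{k+1}(\ell,m)-p_k(\ell,m)\ge d$ for all integers $k$ with $L(d)\le k\le\lfloor \ell m/2\rfloor-1$. Theorem 3.2. Let $d\ge 2$ be an integer and let $n_d$ be an even positive integer with $n_d>L(d)$. Suppose that $\begin{bmatrix}\ell+m\\ m\end{bmatrix}$ is $d$-strictly unimodal for $m=n_d$ and all $\ell\ge n_d$, and also for $m=n_d-1$ and all $\ell\ge n_d-1$. Then $\begin{bmatrix}\ell+m\\ m\end{bmatrix}$ is $d$-strictly unimodal for all integers $\ell,m>n_d$ with $\ell+m$ odd. -/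

import Mathlib

open Polynomial

/-- The numerator `∏_{i=1}^{m} (q^{ℓ+i} - 1)` of the Gaussian polynomial. Numerator and denominator
are both multiplied by `(-1)^m`, which makes them monic and does not change the quotient. -/
noncomputable def gaussNum (ℓ m : ℕ) : ℤ[X] := ∏ i ∈ Finset.Icc 1 m, (X ^ (ℓ + i) - 1)

/-- The denominator `∏_{i=1}^{m} (q^i - 1)` of the Gaussian polynomial. -/
noncomputable def gaussDen (m : ℕ) : ℤ[X] := ∏ i ∈ Finset.Icc 1 m, (X ^ i - 1)

/-- The Gaussian polynomial (`q`-binomial coefficient)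
`[ℓ+m choose m] = ∏_{i=1}^{m} (1 - q^{ℓ+i}) / (1 - q^i)`, as a polynomial in `q = X`.
The division is exact, see `gaussPoly_mul_prod`. -/
noncomputable def gaussPoly (ℓ m : ℕ) : ℤ[X] := gaussNum ℓ m /ₘ gaussDen m

theorem gaussDen_monic (m : ℕ) : (gaussDen m).Monic := by
  unfold gaussDen
  refine monic_prod_of_monic _ _ fun i hi => ?_
  have h : i ≠ 0 := by
    have := (Finset.mem_Icc.1 hi).1
    omega
  simpa using monic_X_pow_sub_C (1 : ℤ) h

theorem gaussNum_shift (ℓ m : ℕ) :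
    (X ^ (ℓ + 1) - 1) * gaussNum (ℓ + 1) m = gaussNum ℓ (m + 1) := by
  induction m with
  | zero => simp [gaussNum]
  | succ m ih =>
    have h1 : gaussNum (ℓ + 1) (m + 1) = gaussNum (ℓ + 1) m * (X ^ (ℓ + 1 + (m + 1)) - 1) :=
      Finset.prod_Icc_succ_top (by omega) _
    have h2 : gaussNum ℓ (m + 1 + 1) = gaussNum ℓ (m + 1) * (X ^ (ℓ + (m + 1 + 1)) - 1) :=
      Finset.prod_Icc_succ_top (by omega) _
    rw [h1, h2, ← mul_assoc, ih]
    congr 3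
    omega

theorem gaussDen_dvd (ℓ m : ℕ) : gaussDen m ∣ gaussNum ℓ m := by
  induction m generalizing ℓ with
  | zero => simp [gaussDen]
  | succ m ihm =>
    induction ℓ with
    | zero => simp [gaussDen, gaussNum]
    | succ ℓ ihl =>
      have h1 : gaussNum (ℓ + 1) (m + 1) = gaussNum (ℓ + 1) m * (X ^ (ℓ + 1 + (m + 1)) - 1) :=
        Finset.prod_Icc_succ_top (by omega) _
      have h2 : gaussDen (m + 1) = gaussDen m * (X ^ (m + 1) - 1) :=
        Finset.prod_Icc_succ_top (by omega) _
      have h3 : gaussNum (ℓ + 1) (m + 1)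
          = X ^ (ℓ + 1) * (gaussNum (ℓ + 1) m * (X ^ (m + 1) - 1)) + gaussNum ℓ (m + 1) := by
        rw [h1, ← gaussNum_shift]
        ring
      rw [h3]
      refine dvd_add (Dvd.dvd.mul_left ?_ _) ihl
      rw [h2]
      exact mul_dvd_mul_right (ihm _) _

/-- The defining property of the quotient `∏_{i=1}^{m} (1 - q^{ℓ+i}) / (1 - q^i)`. -/
theorem gaussPoly_mul_prod (ℓ m : ℕ) :
    gaussPoly ℓ m * ∏ i ∈ Finset.Icc 1 m, (1 - X ^ i) =
      ∏ i ∈ Finset.Icc 1 m, (1 - X ^ (ℓ + i)) := by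
  have h : gaussDen m * gaussPoly ℓ m = gaussNum ℓ m := by
    have h1 := modByMonic_add_div (gaussNum ℓ m) (gaussDen m)
    rwa [(modByMonic_eq_zero_iff_dvd (gaussDen_monic m)).2 (gaussDen_dvd ℓ m), zero_add] at h1
  have e : ∀ f : ℕ → ℤ[X], ∏ i ∈ Finset.Icc 1 m, (1 - f i)
      = (-1) ^ m * ∏ i ∈ Finset.Icc 1 m, (f i - 1) := by
    intro f
    have : (-1 : ℤ[X]) ^ m = ∏ i ∈ Finset.Icc 1 m, (-1 : ℤ[X]) := by simp
    rw [this, ← Finset.prod_mul_distrib]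
    exact Finset.prod_congr rfl fun i _ => by ring
  rw [e, e]
  unfold gaussDen gaussNum at h
  rw [← h]
  ring

/-- `p_k(ℓ, m)`: the coefficient of `q^k` in the Gaussian polynomial `[ℓ+m choose m]`. -/
noncomputable def gaussCoeff (ℓ m k : ℕ) : ℤ := (gaussPoly ℓ m).coeff k

/-- `p(k)`: the number of integer partitions of `k`. -/
def numPartitions (k : ℕ) : ℕ := Fintype.card (Nat.Partition k)

/-- The differences `p(k+1) - p(k)` are unbounded, so the threshold below exists. -/
theorem exists_numPartitions_diff (d : ℕ) :
    ∃ k : ℕ, (d : ℤ) ≤ (numPartitions (k + 1) : ℤ) - numPartitions k := by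
  refine ⟨2 * d + 1, ?_⟩
  let f : Nat.Partition (2 * d + 1) ⊕ Fin d → Nat.Partition (2 * d + 1 + 1) := fun x =>
    match x with
    | Sum.inl a => ⟨1 ::ₘ a.parts, by
        intro i hi
        rcases Multiset.mem_cons.1 hi with h | h
        · omega
        · exact a.parts_pos h, by
        rw [Multiset.sum_cons, a.parts_sum]
        omega⟩
    | Sum.inr i => ⟨{i.1 + 2, 2 * d - i.1}, by
        intro j hj
        have := i.2
        simp only [Multiset.insert_eq_cons, Multiset.mem_cons, Multiset.mem_singleton] at hj
        omega, by
        have := i.2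
        simp only [Multiset.insert_eq_cons, Multiset.sum_cons, Multiset.sum_singleton]
        omega⟩
  have key : ∀ (a : Nat.Partition (2 * d + 1)) (i : Fin d), f (Sum.inl a) ≠ f (Sum.inr i) := by
    intro a i h
    have h1 : (1 : ℕ) ∈ (f (Sum.inr i)).parts := by
      rw [← h]
      exact Multiset.mem_cons_self _ _
    have := i.2
    simp only [f, Multiset.insert_eq_cons, Multiset.mem_cons, Multiset.mem_singleton] at h1
    omega
  have hf : Function.Injective f := by
    rintro (a | i) (b | j) h
    · have h1 : 1 ::ₘ a.parts = 1 ::ₘ b.parts := congrArg Nat.Partition.parts h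
      exact congrArg Sum.inl (Nat.Partition.ext ((Multiset.cons_inj_right 1).1 h1))
    · exact absurd h (key a j)
    · exact absurd h.symm (key b i)
    · have h1 : i.1 + 2 ∈ (f (Sum.inr j)).parts := by
        rw [← h]
        simp [f]
      have hi := i.2
      have hj := j.2
      simp only [f, Multiset.insert_eq_cons, Multiset.mem_cons, Multiset.mem_singleton] at h1
      exact congrArg Sum.inr (Fin.ext (by omega))
  have := Fintype.card_le_of_injective f hf
  rw [Fintype.card_sum, Fintype.card_fin] at this
  unfold numPartitions
  omega

open Classical in
/-- `L(d)`: the smallest natural number `k` with `p(k+1) - p(k) ≥ d`. -/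
noncomputable def thresholdL (d : ℕ) : ℕ := Nat.find (exists_numPartitions_diff d)

/-- The Gaussian polynomial `[ℓ+m choose m]` is `d`-strictly unimodal:
`p_{k+1}(ℓ,m) - p_k(ℓ,m) ≥ d` for all `k = L(d), …, ⌊ℓm/2⌋ - 1`. -/
def IsDStrictlyUnimodal (d ℓ m : ℕ) : Prop :=
  ∀ k : ℕ, thresholdL d ≤ k → k < ℓ * m / 2 →
    (d : ℤ) ≤ gaussCoeff ℓ m (k + 1) - gaussCoeff ℓ m k

/-!
The Gaussian polynomial `[ℓ+m choose m]` is the character of the `SL₂`-module `Sym^m (Sym^ℓ ℚ²)`,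
so below the middle the difference `p_{k+1}(ℓ,m) - p_k(ℓ,m)` is the number of independent highest
weight vectors of the corresponding weight. In the dehomogenized model used here these are the
symmetric polynomials in `m` variables, homogeneous of degree `k + 1`, of degree at most `ℓ` in each
variable, and killed by `∑ i, ∂/∂x_i`. That their dimension is the stated difference needs the
monomial count (`gaussCoeff_eq_card`, `finrank_boxSymmetric`) and the surjectivity of the lowering
operator below the middle (`lowerMap_surjective`).

Polynomials form a domain, so multiplication by a fixed nonzero highest weight vector is injective
on highest weight vectors (`gaussCoeff_sub_le_of_lower_eq_zero`). Two multipliers are used.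

* The constant `1`, viewed as having degree at most `1` in each variable, shows that the differences
  grow with `ℓ` (`gaussCoeff_sub_le_succ`).
* For even `m`, the symmetrization of `(x₁ - x₂)² (x₃ - x₄)² ⋯ (x_{m-1} - x_m)²`, of degree `m` and
  of degree at most `2` in each variable, bounds the difference at `(ℓ + 2, m, k + m)` from below by
  the one at `(ℓ, m, k)` (`gaussCoeff_sub_le_add_two`).

As `ℓ + m` is odd, by symmetry `m` is even and `ℓ` is odd. If `k < nm/2`, the bound follows from the
box `n × m` by growth. Otherwise `k ≥ 2m ≥ L(d) + m`, as `n ≥ 4`, and the bound follows from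
`(ℓ - 2, m)` at `k - m`. This descent in `ℓ` stays among the odd numbers and ends at `n - 1`, where
the second hypothesis applies.
-/

/-! ### Gaussian coefficients count partitions in a box -/

theorem gaussDen_mul_gaussPoly (ℓ m : ℕ) : gaussDen m * gaussPoly ℓ m = gaussNum ℓ m := by
  have h := modByMonic_add_div (gaussNum ℓ m) (gaussDen m)
  rwa [(modByMonic_eq_zero_iff_dvd (gaussDen_monic m)).2 (gaussDen_dvd ℓ m), zero_add] at h

theorem gaussDen_succ (m : ℕ) : gaussDen (m + 1) = gaussDen m * (X ^ (m + 1) - 1) :=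
  Finset.prod_Icc_succ_top (by omega) _

theorem gaussNum_succ (ℓ m : ℕ) :
    gaussNum ℓ (m + 1) = gaussNum ℓ m * (X ^ (ℓ + (m + 1)) - 1) :=
  Finset.prod_Icc_succ_top (by omega) _

theorem gaussNum_mul_gaussDen (ℓ m : ℕ) : gaussNum ℓ m * gaussDen ℓ = gaussDen (ℓ + m) := by
  induction m with
  | zero => simp [gaussNum]
  | succ m ih => rw [gaussNum_succ, ← add_assoc, gaussDen_succ, ← ih]; ring_nf

theorem gaussPoly_comm (ℓ m : ℕ) : gaussPoly ℓ m = gaussPoly m ℓ := by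
  have h : gaussDen ℓ * gaussDen m * gaussPoly ℓ m = gaussDen ℓ * gaussDen m * gaussPoly m ℓ := by
    calc gaussDen ℓ * gaussDen m * gaussPoly ℓ m = gaussNum ℓ m * gaussDen ℓ := by
          rw [← gaussDen_mul_gaussPoly]; ring
      _ = gaussNum m ℓ * gaussDen m := by
          rw [gaussNum_mul_gaussDen, gaussNum_mul_gaussDen, add_comm]
      _ = _ := by rw [← gaussDen_mul_gaussPoly]; ring
  exact mul_left_cancel₀ (mul_ne_zero (gaussDen_monic ℓ).ne_zero (gaussDen_monic m).ne_zero) h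

theorem gaussPoly_zero_right (ℓ : ℕ) : gaussPoly ℓ 0 = 1 := by
  simp [gaussPoly, gaussNum, gaussDen]

/-- The Pascal recurrence of the Gaussian polynomials. -/
theorem gaussPoly_succ_succ (ℓ m : ℕ) :
    gaussPoly (ℓ + 1) (m + 1) = X ^ (ℓ + 1) * gaussPoly (ℓ + 1) m + gaussPoly ℓ (m + 1) := by
  refine mul_left_cancel₀ (gaussDen_monic (m + 1)).ne_zero ?_
  have e : gaussDen (m + 1) * (X ^ (ℓ + 1) * gaussPoly (ℓ + 1) m)
      = X ^ (ℓ + 1) * ((X ^ (m + 1) - 1) * gaussNum (ℓ + 1) m) := by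
    rw [gaussDen_succ, ← gaussDen_mul_gaussPoly]
    ring
  rw [mul_add, e, gaussDen_mul_gaussPoly, gaussDen_mul_gaussPoly, gaussNum_succ, ← gaussNum_shift]
  ring

/-- The multisets of `m` natural numbers, all at most `ℓ`, with sum `k`: partitions of `k` in an
`ℓ × m` box, padded with zeros to exactly `m` parts. -/
def boxMultisets (ℓ m k : ℕ) : Finset (Multiset ℕ) :=
  (((Finset.range (ℓ + 1)).sym m).image Sym.toMultiset).filter fun s => s.sum = k

theorem mem_boxMultisets {ℓ m k : ℕ} {s : Multiset ℕ} :
    s ∈ boxMultisets ℓ m k ↔ s.card = m ∧ (∀ a ∈ s, a ≤ ℓ) ∧ s.sum = k := by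
  simp only [boxMultisets, Finset.mem_filter, Finset.mem_image, Finset.mem_sym_iff,
    Finset.mem_range, Nat.lt_succ_iff]
  constructor
  · rintro ⟨⟨t, ht, rfl⟩, hk⟩
    exact ⟨t.2, fun a ha => ht a ha, hk⟩
  · rintro ⟨hm, hl, hk⟩
    exact ⟨⟨⟨s, hm⟩, fun a ha => hl a ha, rfl⟩, hk⟩

theorem boxMultisets_succ_succ (ℓ m k : ℕ) :
    (boxMultisets (ℓ + 1) (m + 1) k).card =
      (if ℓ + 1 ≤ k then (boxMultisets (ℓ + 1) m (k - (ℓ + 1))).card else 0) +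
        (boxMultisets ℓ (m + 1) k).card := by
  rw [← Finset.card_filter_add_card_filter_not (s := boxMultisets (ℓ + 1) (m + 1) k)
    (fun s => ℓ + 1 ∈ s)]
  congr 1
  · split_ifs with h
    · symm
      refine Finset.card_bij (fun s _ => (ℓ + 1) ::ₘ s) ?_ ?_ ?_
      · intro s hs
        obtain ⟨h1, h2, h3⟩ := mem_boxMultisets.1 hs
        refine Finset.mem_filter.2 ⟨mem_boxMultisets.2 ⟨by simp [h1], ?_, ?_⟩, by simp⟩
        · intro a ha
          rcases Multiset.mem_cons.1 ha with rfl | ha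
          · exact le_rfl
          · exact h2 a ha
        · rw [Multiset.sum_cons, h3]; omega
      · intro s _ t _ hst
        exact (Multiset.cons_inj_right _).1 hst
      · intro s hs
        obtain ⟨hs, hmem⟩ := Finset.mem_filter.1 hs
        obtain ⟨t, rfl⟩ := Multiset.exists_cons_of_mem hmem
        obtain ⟨h1, h2, h3⟩ := mem_boxMultisets.1 hs
        rw [Multiset.card_cons] at h1
        rw [Multiset.sum_cons] at h3
        exact ⟨t, mem_boxMultisets.2
          ⟨by omega, fun a ha => h2 a (Multiset.mem_cons_of_mem ha), by omega⟩, rfl⟩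
    · rw [Finset.card_eq_zero, Finset.filter_eq_empty_iff]
      intro s hs hmem
      have := Multiset.le_sum_of_mem hmem
      rw [(mem_boxMultisets.1 hs).2.2] at this
      exact h this
  · congr 1
    ext s
    simp only [Finset.mem_filter, mem_boxMultisets]
    constructor
    · rintro ⟨⟨h1, h2, h3⟩, h4⟩
      refine ⟨h1, fun a ha => ?_, h3⟩
      have h5 := h2 a ha
      have h6 : a ≠ ℓ + 1 := by rintro rfl; exact h4 ha
      omega
    · rintro ⟨h1, h2, h3⟩
      exact ⟨⟨h1, fun a ha => (h2 a ha).trans (by omega), h3⟩, fun h => by have := h2 _ h; omega⟩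

theorem card_boxMultisets_zero_right (ℓ k : ℕ) :
    (boxMultisets ℓ 0 k).card = if k = 0 then 1 else 0 := by
  split_ifs with h
  · rw [Finset.card_eq_one]
    refine ⟨0, Finset.ext fun s => ?_⟩
    rw [mem_boxMultisets, Finset.mem_singleton, Multiset.card_eq_zero]
    exact ⟨fun hs => hs.1, fun hs => by subst hs; simp [h]⟩
  · rw [Finset.card_eq_zero, Finset.eq_empty_iff_forall_notMem]
    intro s hs
    obtain ⟨h1, -, h3⟩ := mem_boxMultisets.1 hs
    rw [Multiset.card_eq_zero.1 h1] at h3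
    exact h (by simpa using h3.symm)

theorem card_boxMultisets_zero_left (m k : ℕ) :
    (boxMultisets 0 m k).card = if k = 0 then 1 else 0 := by
  have key : ∀ s : Multiset ℕ, s ∈ boxMultisets 0 m k ↔ s = Multiset.replicate m 0 ∧ k = 0 := by
    intro s
    rw [mem_boxMultisets, Multiset.eq_replicate]
    constructor
    · rintro ⟨h1, h2, h3⟩
      have h4 : ∀ a ∈ s, a = 0 := fun a ha => Nat.le_zero.1 (h2 a ha)
      exact ⟨⟨h1, h4⟩, by rw [← h3, Multiset.sum_eq_zero h4]⟩
    · rintro ⟨⟨h1, h2⟩, rfl⟩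
      exact ⟨h1, fun a ha => (h2 a ha).le, Multiset.sum_eq_zero h2⟩
  split_ifs with h
  · rw [Finset.card_eq_one]
    exact ⟨Multiset.replicate m 0, Finset.ext fun s => by rw [key, Finset.mem_singleton, and_iff_left h]⟩
  · rw [Finset.card_eq_zero, Finset.eq_empty_iff_forall_notMem]
    exact fun s hs => h ((key s).1 hs).2

/-- The coefficients of the Gaussian polynomial count partitions in a box. -/
theorem gaussCoeff_eq_card (ℓ m k : ℕ) : gaussCoeff ℓ m k = (boxMultisets ℓ m k).card := by
  unfold gaussCoeff
  induction m generalizing ℓ k with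
  | zero => rw [gaussPoly_zero_right, card_boxMultisets_zero_right, coeff_one]; simp
  | succ m ihm =>
    induction ℓ generalizing k with
    | zero =>
      rw [gaussPoly_comm, gaussPoly_zero_right, card_boxMultisets_zero_left, coeff_one]; simp
    | succ ℓ ihl =>
      rw [gaussPoly_succ_succ, boxMultisets_succ_succ, coeff_add, coeff_X_pow_mul', ihl]
      split_ifs <;> simp [ihm]

/-! ### Symmetric polynomials of bounded degree in each variable -/

namespace MvPolynomial

variable {σ : Type*}

theorem isSymmetric_iff_coeff {f : MvPolynomial σ ℚ} :
    f.IsSymmetric ↔ ∀ (e : Equiv.Perm σ) (d : σ →₀ ℕ), coeff (d.mapDomain e) f = coeff d f := by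
  constructor
  · intro h e d
    conv_lhs => rw [← h e]
    exact coeff_rename_mapDomain e e.injective f d
  · intro h e
    ext d
    have hd : d = (d.mapDomain e.symm).mapDomain e := by
      rw [← Finsupp.mapDomain_comp]
      simp
    conv_lhs => rw [hd]
    rw [coeff_rename_mapDomain e e.injective, ← h e, ← hd]

variable [Fintype σ]

/-- Symmetric polynomials over `ℚ`, homogeneous of degree `k`, of degree at most `ℓ` in each
variable. With `m` variables this is a model of a weight space of `Sym^m (Sym^ℓ ℚ²)`. -/
noncomputable def boxSymmetric (σ : Type*) [Fintype σ] (ℓ k : ℕ) : Submodule ℚ (MvPolynomial σ ℚ) :=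
  Subalgebra.toSubmodule (symmetricSubalgebra σ ℚ) ⊓ homogeneousSubmodule σ ℚ k ⊓
    restrictDegree σ ℚ ℓ

theorem mem_boxSymmetric {ℓ k : ℕ} {f : MvPolynomial σ ℚ} :
    f ∈ boxSymmetric σ ℓ k ↔
      f.IsSymmetric ∧ f.IsHomogeneous k ∧ ∀ d : σ →₀ ℕ, coeff d f ≠ 0 → ∀ i, d i ≤ ℓ := by
  simp only [boxSymmetric, Submodule.mem_inf, Subalgebra.mem_toSubmodule, mem_symmetricSubalgebra,
    mem_homogeneousSubmodule, mem_restrictDegree, mem_support_iff, and_assoc]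

/-- The weight in the definition of `IsHomogeneous` is the sum of the exponents. -/
theorem weight_one_eq_sum (d : σ →₀ ℕ) : Finsupp.weight (1 : σ → ℕ) d = ∑ i, d i := by
  simp [Finsupp.weight_apply, Finsupp.sum_fintype]

/-- The multiset of all exponents of a monomial, zeros included. -/
def exponents (d : σ →₀ ℕ) : Multiset ℕ := Finset.univ.val.map d

theorem exists_perm_of_exponents_eq {d d' : σ →₀ ℕ} (h : exponents d = exponents d') :
    ∃ e : Equiv.Perm σ, d.mapDomain e = d' := by
  classical
  have hc : ∀ c : ℕ, Nonempty ({a // d a = c} ≃ {a // d' a = c}) := by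
    intro c
    rw [← Fintype.card_eq, Fintype.card_subtype, Fintype.card_subtype]
    have := congrArg (Multiset.count c) h
    simp only [exponents, Multiset.count_map] at this
    simpa [Finset.card, eq_comm] using this
  let e := Equiv.ofFiberEquiv fun c => (hc c).some
  have he : ∀ a, d' (e a) = d a := fun a => Equiv.ofFiberEquiv_map _ a
  refine ⟨e, ?_⟩
  ext a
  obtain ⟨b, rfl⟩ := e.surjective a
  rw [Finsupp.mapDomain_apply e.injective, he]

theorem exponents_mapDomain (e : Equiv.Perm σ) (d : σ →₀ ℕ) :
    exponents (d.mapDomain e) = exponents d := by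
  unfold exponents
  conv_lhs => rw [← Multiset.map_univ_val_equiv e, Multiset.map_map]
  exact Multiset.map_congr rfl fun a _ => Finsupp.mapDomain_apply e.injective d a

theorem exists_exponents_eq {s : Multiset ℕ} (h : s.card = Fintype.card σ) :
    ∃ d : σ →₀ ℕ, exponents d = s := by
  classical
  induction s using Quotient.inductionOn with
  | _ l =>
  have hl : l.length = Fintype.card σ := h
  let e : σ ≃ Fin l.length := (Fintype.equivFin σ).trans (finCongr hl.symm)
  refine ⟨Finsupp.equivFunOnFinite.symm fun i => l.get (e i), ?_⟩
  change Multiset.map (fun i => l.get (e i)) Finset.univ.val = (l : Multiset ℕ)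
  have := Multiset.map_univ_val_equiv e
  rw [← Function.comp_def, ← Multiset.map_map, this, Fin.univ_val_map]
  simp

theorem exponents_mem_boxMultisets {ℓ k : ℕ} {d : σ →₀ ℕ} :
    exponents d ∈ boxMultisets ℓ (Fintype.card σ) k ↔ (∀ i, d i ≤ ℓ) ∧ ∑ i, d i = k := by
  rw [mem_boxMultisets]
  simp [exponents]

/-- The coefficients of `f` at one representative monomial for each exponent multiset. -/
noncomputable def orbitCoeff (σ : Type*) [Fintype σ] (ℓ k : ℕ) :
    boxSymmetric σ ℓ k →ₗ[ℚ] (boxMultisets ℓ (Fintype.card σ) k → ℚ) :=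
  LinearMap.pi fun s =>
    (lcoeff ℚ (exists_exponents_eq (σ := σ) (mem_boxMultisets.1 s.2).1).choose).domRestrict _

theorem orbitCoeff_apply {ℓ k : ℕ} (f : boxSymmetric σ ℓ k) (d : σ →₀ ℕ)
    (hd : exponents d ∈ boxMultisets ℓ (Fintype.card σ) k) :
    orbitCoeff σ ℓ k f ⟨exponents d, hd⟩ = coeff d f.1 := by
  have hs := (exists_exponents_eq (σ := σ) (mem_boxMultisets.1 hd).1).choose_spec
  obtain ⟨e, he⟩ := exists_perm_of_exponents_eq hs.symm
  change coeff _ f.1 = _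
  rw [← he]
  exact isSymmetric_iff_coeff.1 (mem_boxSymmetric.1 f.2).1 e d

theorem orbitCoeff_injective (ℓ k : ℕ) : Function.Injective (orbitCoeff σ ℓ k) := by
  rw [← LinearMap.ker_eq_bot, LinearMap.ker_eq_bot']
  intro f hf
  obtain ⟨-, h2, h3⟩ := mem_boxSymmetric.1 f.2
  ext d
  by_contra hne
  have hne' : coeff d f.1 ≠ 0 := hne
  have hd : exponents d ∈ boxMultisets ℓ (Fintype.card σ) k := by
    refine exponents_mem_boxMultisets.2 ⟨h3 d hne', ?_⟩
    have := h2 hne'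
    rwa [weight_one_eq_sum] at this
  apply hne'
  rw [← orbitCoeff_apply f d hd, hf]
  rfl

open Classical in
theorem orbitCoeff_surjective (ℓ k : ℕ) : Function.Surjective (orbitCoeff σ ℓ k) := by
  intro φ
  let ψ : Multiset ℕ → ℚ := fun s =>
    if h : s ∈ boxMultisets ℓ (Fintype.card σ) k then φ ⟨s, h⟩ else 0
  let f : MvPolynomial σ ℚ :=
    ∑ d ∈ Finset.univ.finsuppAntidiag k, monomial d (ψ (exponents d))
  have hψ : ∀ d : σ →₀ ℕ, ψ (exponents d) ≠ 0 → (∀ i, d i ≤ ℓ) ∧ ∑ i, d i = k := by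
    intro d hd
    by_contra hn
    rw [← exponents_mem_boxMultisets] at hn
    exact hd (dif_neg hn)
  have hf : ∀ d, coeff d f = ψ (exponents d) := by
    intro d
    simp only [f, coeff_sum, coeff_monomial, Finset.sum_ite_eq', Finset.mem_finsuppAntidiag,
      Finset.subset_univ, and_true]
    split_ifs with h
    · rfl
    · by_contra hn
      exact h (hψ d (Ne.symm hn)).2
  have hmem : f ∈ boxSymmetric σ ℓ k := by
    refine mem_boxSymmetric.2
      ⟨isSymmetric_iff_coeff.2 fun e d => ?_, fun d hd => ?_, fun d hd => ?_⟩
    · rw [hf, hf, exponents_mapDomain]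
    · rw [hf] at hd
      rw [weight_one_eq_sum]
      exact (hψ d hd).2
    · rw [hf] at hd
      exact (hψ d hd).1
  refine ⟨⟨f, hmem⟩, ?_⟩
  ext ⟨s, hs⟩
  obtain ⟨d, rfl⟩ := exists_exponents_eq (σ := σ) (mem_boxMultisets.1 hs).1
  rw [orbitCoeff_apply]
  change coeff d f = _
  rw [hf]
  exact dif_pos hs

/-- A symmetric polynomial is determined by its coefficients, one for each exponent multiset, and
these are arbitrary. -/
noncomputable def orbitCoeffEquiv (σ : Type*) [Fintype σ] (ℓ k : ℕ) :
    boxSymmetric σ ℓ k ≃ₗ[ℚ] (boxMultisets ℓ (Fintype.card σ) k → ℚ) :=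
  LinearEquiv.ofBijective (orbitCoeff σ ℓ k) ⟨orbitCoeff_injective ℓ k, orbitCoeff_surjective ℓ k⟩

instance finiteDimensional_boxSymmetric (ℓ k : ℕ) : FiniteDimensional ℚ (boxSymmetric σ ℓ k) :=
  Module.Finite.equiv (orbitCoeffEquiv σ ℓ k).symm

theorem finrank_boxSymmetric (ℓ k : ℕ) :
    (Module.finrank ℚ (boxSymmetric σ ℓ k) : ℤ) = gaussCoeff ℓ (Fintype.card σ) k := by
  rw [(orbitCoeffEquiv σ ℓ k).finrank_eq, gaussCoeff_eq_card, Module.finrank_fintype_fun_eq_card,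
    Fintype.card_coe]

end MvPolynomial

/-! ### The `sl₂`-action and highest weight vectors -/

namespace MvPolynomial

variable {σ : Type*}

theorem coeff_X_mul_pderiv (i : σ) (f : MvPolynomial σ ℚ) (d : σ →₀ ℕ) :
    coeff d (X i * pderiv i f) = d i * coeff d f := by
  classical
  rw [coeff_X_mul']
  split_ifs with h
  · have hi : d i ≠ 0 := Finsupp.mem_support_iff.1 h
    have hd : d - Finsupp.single i 1 + Finsupp.single i 1 = d :=
      tsub_add_cancel_of_le (Finsupp.single_le_iff.2 (Nat.one_le_iff_ne_zero.2 hi))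
    rw [coeff_pderiv, hd, Finsupp.tsub_apply, Finsupp.single_eq_same,
      Nat.cast_sub (Nat.one_le_iff_ne_zero.2 hi)]
    push_cast
    ring
  · rw [Finsupp.notMem_support_iff.1 h]
    simp

variable [Fintype σ]

/-- The lowering operator `∑ i, ∂/∂x_i` of the `sl₂`-action. Its kernel consists of the
translation-invariant polynomials. -/
noncomputable def lower (σ : Type*) [Fintype σ] :
    Derivation ℚ (MvPolynomial σ ℚ) (MvPolynomial σ ℚ) := ∑ i, pderiv i

/-- The raising operator `∑ i, (ℓ x_i - x_i² ∂/∂x_i)` of the `sl₂`-action. -/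
noncomputable def raise (σ : Type*) [Fintype σ] (ℓ : ℕ) :
    MvPolynomial σ ℚ →ₗ[ℚ] MvPolynomial σ ℚ :=
  ∑ i, LinearMap.mulLeft ℚ (X i) ∘ₗ
    ((ℓ : ℚ) • LinearMap.id - LinearMap.mulLeft ℚ (X i) ∘ₗ (pderiv i).toLinearMap)

theorem lower_apply (f : MvPolynomial σ ℚ) : lower σ f = ∑ i, pderiv i f := by
  rw [lower, ← Derivation.coeFnAddMonoidHom_apply, map_sum, Finset.sum_apply]
  rfl

theorem raise_apply (ℓ : ℕ) (f : MvPolynomial σ ℚ) :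
    raise σ ℓ f = ∑ i, X i * ((ℓ : ℚ) • f - X i * pderiv i f) := by
  simp [raise]

theorem lower_X (i : σ) : lower σ (X i) = 1 := by
  classical
  simp [lower_apply, pderiv_X, Pi.single_apply]

theorem lower_pderiv (i : σ) (f : MvPolynomial σ ℚ) :
    lower σ (pderiv i f) = pderiv i (lower σ f) := by
  classical
  have h : ⁅lower σ, pderiv i⁆ = (0 : Derivation ℚ (MvPolynomial σ ℚ) (MvPolynomial σ ℚ)) := by
    refine derivation_ext fun j => ?_
    rw [Derivation.commutator_apply, lower_X, pderiv_X, Pi.single_apply]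
    split_ifs <;> simp
  have := DFunLike.congr_fun h f
  rwa [Derivation.commutator_apply, Derivation.zero_apply, sub_eq_zero] at this

/-- The relation `[lower, raise] = weight` of `sl₂`. -/
theorem lower_raise {ℓ k : ℕ} {f : MvPolynomial σ ℚ} (hf : f.IsHomogeneous k) :
    lower σ (raise σ ℓ f) =
      raise σ ℓ (lower σ f) + ((ℓ : ℚ) * Fintype.card σ - 2 * k) • f := by
  have h1 : lower σ (raise σ ℓ f) = raise σ ℓ (lower σ f) +
      ∑ i, ((ℓ : ℚ) • f - 2 * (X i * pderiv i f)) := by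
    rw [raise_apply, raise_apply, map_sum, ← Finset.sum_add_distrib]
    refine Finset.sum_congr rfl fun i _ => ?_
    rw [Derivation.leibniz, map_sub, Derivation.map_smul, Derivation.leibniz, lower_X,
      lower_pderiv]
    simp only [smul_eq_mul, smul_eq_C_mul]
    ring
  rw [h1, Finset.sum_sub_distrib, ← Finset.mul_sum, hf.sum_X_mul_pderiv, Finset.sum_const,
    Finset.card_univ]
  congr 1
  rw [sub_smul, mul_smul, mul_smul]
  simp only [smul_eq_C_mul, nsmul_eq_mul, map_natCast, map_ofNat]
  ring

theorem lower_eq_zero_of_isHomogeneous_zero {f : MvPolynomial σ ℚ} (hf : f.IsHomogeneous 0) :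
    lower σ f = 0 := by
  rw [← totalDegree_zero_iff_isHomogeneous, totalDegree_eq_zero_iff_eq_C] at hf
  rw [hf, lower_apply]
  simp

theorem lower_mem {ℓ k : ℕ} {f : MvPolynomial σ ℚ} (hf : f ∈ boxSymmetric σ ℓ (k + 1)) :
    lower σ f ∈ boxSymmetric σ ℓ k := by
  obtain ⟨h1, h2, h3⟩ := mem_boxSymmetric.1 hf
  refine mem_boxSymmetric.2 ⟨fun e => ?_, ?_, fun d hd => ?_⟩
  · rw [lower_apply, map_sum]
    simp only [← pderiv_rename e.injective, h1 e]
    exact Equiv.sum_comp e fun i => pderiv i f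
  · rw [lower_apply]
    exact IsHomogeneous.sum _ _ _ fun i _ => h2.pderiv
  · rw [lower_apply, coeff_sum] at hd
    obtain ⟨i, -, hi⟩ := Finset.exists_ne_zero_of_sum_ne_zero hd
    rw [coeff_pderiv] at hi
    intro j
    refine le_trans ?_ (h3 _ (left_ne_zero_of_mul hi) j)
    rw [Finsupp.add_apply]
    exact Nat.le_add_right _ _

/-- The term `x_i^(ℓ+1)` cancels in the raising operator, so the bound `ℓ` on the degree in each
variable is kept. -/
theorem raise_mem {ℓ k : ℕ} {f : MvPolynomial σ ℚ} (hf : f ∈ boxSymmetric σ ℓ k) :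
    raise σ ℓ f ∈ boxSymmetric σ ℓ (k + 1) := by
  classical
  obtain ⟨h1, h2, h3⟩ := mem_boxSymmetric.1 hf
  refine mem_boxSymmetric.2 ⟨fun e => ?_, ?_, fun d hd => ?_⟩
  · rw [raise_apply, map_sum]
    simp only [map_mul, map_sub, map_smul, rename_X, ← pderiv_rename e.injective, h1 e]
    exact Equiv.sum_comp e fun i => X i * ((ℓ : ℚ) • f - X i * pderiv i f)
  · rw [raise_apply]
    refine IsHomogeneous.sum _ _ _ fun i _ => ?_
    rw [add_comm k 1]
    refine (isHomogeneous_X ℚ i).mul (IsHomogeneous.sub ?_ ?_)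
    · exact (homogeneousSubmodule σ ℚ k).smul_mem _ h2
    · intro d hd
      rw [coeff_X_mul_pderiv] at hd
      exact h2 (right_ne_zero_of_mul hd)
  · rw [raise_apply, coeff_sum] at hd
    obtain ⟨i, -, hi⟩ := Finset.exists_ne_zero_of_sum_ne_zero hd
    rw [coeff_X_mul'] at hi
    split_ifs at hi with hs
    · rw [coeff_sub, coeff_smul, coeff_X_mul_pderiv, smul_eq_mul, ← sub_mul] at hi
      have hle := h3 _ (right_ne_zero_of_mul hi)
      have hne : (d - Finsupp.single i 1 : σ →₀ ℕ) i ≠ ℓ := by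
        intro h
        rw [h, sub_self, zero_mul] at hi
        exact hi rfl
      intro j
      have hj := hle j
      rw [Finsupp.tsub_apply] at hj hne
      by_cases hij : i = j
      · subst hij
        rw [Finsupp.single_eq_same] at hj hne
        omega
      · rwa [Finsupp.single_eq_of_ne' hij, Nat.sub_zero] at hj
    · exact absurd rfl hi

/-- On weights below the middle, `lower ∘ raise + c` is injective for `c ≥ 0`: if it kills `f`, then
`raise ∘ lower + c'` does with `c' > 0`, so that `lower ∘ raise + c'` kills `lower f`. -/
theorem eq_zero_of_lower_raise_add_smul {ℓ k : ℕ} (hk : 2 * k < ℓ * Fintype.card σ)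
    {c : ℚ} (hc : 0 ≤ c) {f : MvPolynomial σ ℚ} (hf : f ∈ boxSymmetric σ ℓ k)
    (h : lower σ (raise σ ℓ f) + c • f = 0) : f = 0 := by
  induction k generalizing c f with
  | zero =>
    have hhom := (mem_boxSymmetric.1 hf).2.1
    have hpos : (0 : ℚ) < ℓ * Fintype.card σ := by exact_mod_cast hk
    rw [lower_raise hhom, lower_eq_zero_of_isHomogeneous_zero hhom, map_zero, zero_add,
      ← add_smul] at h
    refine (smul_eq_zero.1 h).resolve_left ?_
    push_cast
    linarith
  | succ k ih =>
    have hhom := (mem_boxSymmetric.1 hf).2.1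
    have hpos : (2 : ℚ) * (k + 1 : ℕ) < ℓ * Fintype.card σ := by exact_mod_cast hk
    rw [lower_raise hhom, add_assoc, ← add_smul] at h
    have hc' : 0 < (ℓ : ℚ) * Fintype.card σ - 2 * (k + 1 : ℕ) + c := by linarith
    have h0 : lower σ f = 0 := by
      refine ih (by omega) hc'.le (lower_mem hf) ?_
      have := congrArg (lower σ) h
      rwa [map_add, Derivation.map_smul, map_zero] at this
    rw [h0, map_zero, zero_add] at h
    exact (smul_eq_zero.1 h).resolve_left hc'.ne'

/-- The lowering operator between consecutive weight spaces. -/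
noncomputable def lowerMap (σ : Type*) [Fintype σ] (ℓ k : ℕ) :
    boxSymmetric σ ℓ (k + 1) →ₗ[ℚ] boxSymmetric σ ℓ k :=
  (lower σ).toLinearMap.restrict fun _ hf => lower_mem hf

theorem lowerMap_surjective {ℓ k : ℕ} (hk : 2 * k < ℓ * Fintype.card σ) :
    Function.Surjective (lowerMap σ ℓ k) := by
  -- It suffices that the endomorphism `lower ∘ raise` is injective, by finite dimension.
  let T : boxSymmetric σ ℓ k →ₗ[ℚ] boxSymmetric σ ℓ k :=
    lowerMap σ ℓ k ∘ₗ (raise σ ℓ).restrict fun _ hf => raise_mem hf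
  have hT : Function.Injective T := by
    rw [← LinearMap.ker_eq_bot, LinearMap.ker_eq_bot']
    intro f hf
    refine Subtype.ext (eq_zero_of_lower_raise_add_smul hk le_rfl f.2 ?_)
    rw [zero_smul, add_zero]
    exact congrArg Subtype.val hf
  exact Function.Surjective.of_comp (LinearMap.injective_iff_surjective.1 hT)

/-- This half of the dimension count holds in all degrees, as it does not use surjectivity. -/
theorem gaussCoeff_sub_le_finrank_ker (ℓ k : ℕ) :
    gaussCoeff ℓ (Fintype.card σ) (k + 1) - gaussCoeff ℓ (Fintype.card σ) k ≤
      Module.finrank ℚ (LinearMap.ker (lowerMap σ ℓ k)) := by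
  have h1 := (lowerMap σ ℓ k).finrank_range_add_finrank_ker
  have h2 := Submodule.finrank_le (LinearMap.range (lowerMap σ ℓ k))
  rw [← finrank_boxSymmetric, ← finrank_boxSymmetric]
  omega

theorem finrank_ker_lowerMap {ℓ k : ℕ} (hk : 2 * k < ℓ * Fintype.card σ) :
    (Module.finrank ℚ (LinearMap.ker (lowerMap σ ℓ k)) : ℤ) =
      gaussCoeff ℓ (Fintype.card σ) (k + 1) - gaussCoeff ℓ (Fintype.card σ) k := by
  have h1 := (lowerMap σ ℓ k).finrank_range_add_finrank_ker
  rw [LinearMap.range_eq_top.2 (lowerMap_surjective hk), finrank_top] at h1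
  rw [← finrank_boxSymmetric, ← finrank_boxSymmetric]
  omega

theorem mul_mem_boxSymmetric {a b ℓ k : ℕ} {Q f : MvPolynomial σ ℚ}
    (hQ : Q ∈ boxSymmetric σ a b) (hf : f ∈ boxSymmetric σ ℓ k) :
    Q * f ∈ boxSymmetric σ (ℓ + a) (k + b) := by
  classical
  obtain ⟨h1, h2, h3⟩ := mem_boxSymmetric.1 hQ
  obtain ⟨h1', h2', h3'⟩ := mem_boxSymmetric.1 hf
  refine mem_boxSymmetric.2 ⟨h1.mul h1', add_comm b k ▸ h2.mul h2', fun d hd i => ?_⟩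
  rw [coeff_mul] at hd
  obtain ⟨⟨x, y⟩, hxy, hne⟩ := Finset.exists_ne_zero_of_sum_ne_zero hd
  rw [← Finset.HasAntidiagonal.mem_antidiagonal.1 hxy, Finsupp.add_apply, add_comm]
  exact add_le_add (h3' _ (right_ne_zero_of_mul hne) i) (h3 _ (left_ne_zero_of_mul hne) i)

/-- Multiplication by a highest weight vector `Q` embeds highest weight vectors into highest weight
vectors, since polynomials have no zero divisors. Below the middle, their number is the difference
of consecutive coefficients of the Gaussian polynomial. -/
theorem gaussCoeff_sub_le_of_lower_eq_zero {a b ℓ k : ℕ} {Q : MvPolynomial σ ℚ}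
    (hQ : Q ∈ boxSymmetric σ a b) (hQ0 : Q ≠ 0) (hlower : lower σ Q = 0)
    (hk : 2 * (k + b) < (ℓ + a) * Fintype.card σ) :
    gaussCoeff ℓ (Fintype.card σ) (k + 1) - gaussCoeff ℓ (Fintype.card σ) k ≤
      gaussCoeff (ℓ + a) (Fintype.card σ) (k + b + 1) -
        gaussCoeff (ℓ + a) (Fintype.card σ) (k + b) := by
  rw [← finrank_ker_lowerMap hk]
  refine (gaussCoeff_sub_le_finrank_ker (σ := σ) ℓ k).trans ?_
  let M : boxSymmetric σ ℓ (k + 1) →ₗ[ℚ] boxSymmetric σ (ℓ + a) (k + b + 1) :=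
    (LinearMap.mulLeft ℚ Q).restrict fun f hf =>
      (by omega : k + 1 + b = k + b + 1) ▸ mul_mem_boxSymmetric hQ hf
  have hM : ∀ f, (M f).1 = Q * f.1 := fun f => rfl
  have hker : ∀ f ∈ LinearMap.ker (lowerMap σ ℓ k),
      M f ∈ LinearMap.ker (lowerMap σ (ℓ + a) (k + b)) := by
    intro f hf
    have hf' : lower σ f.1 = 0 := congrArg Subtype.val (LinearMap.mem_ker.1 hf)
    refine LinearMap.mem_ker.2 (Subtype.ext ?_)
    change lower σ (Q * f.1) = 0
    rw [Derivation.leibniz, hf', hlower, smul_zero, smul_zero, add_zero]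
  refine Int.ofNat_le.2 (LinearMap.finrank_le_finrank_of_injective (f := M.restrict hker) ?_)
  intro f g hfg
  have h : Q * f.1.1 = Q * g.1.1 := congrArg (fun x => x.1.1) hfg
  exact Subtype.ext (Subtype.ext (mul_left_cancel₀ hQ0 h))

end MvPolynomial

/-! ### Two highest weight vectors -/

namespace MvPolynomial

section

variable {σ : Type*} [Fintype σ]

theorem lower_rename (e : Equiv.Perm σ) (f : MvPolynomial σ ℚ) :
    lower σ (rename e f) = rename e (lower σ f) := by
  rw [lower_apply, lower_apply, map_sum, ← Equiv.sum_comp e]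
  exact Finset.sum_congr rfl fun i _ => pderiv_rename e.injective i f

end

/-- The product `∏ i, (x_i - y_i)²` in the `2r` variables `x_i = X (i, true)` and
`y_i = X (i, false)`. -/
noncomputable def pairDiffSq (r : ℕ) : MvPolynomial (Fin r × Bool) ℚ :=
  ∏ i, (X (i, true) - X (i, false)) ^ 2

/-- The symmetrization of `∏ i, (x_i - y_i)²`: the `SL₂`-invariant in `Sym^m (Sym² ℚ²)`, `m = 2r`. -/
noncomputable def symPairDiffSq (r : ℕ) : MvPolynomial (Fin r × Bool) ℚ :=
  ∑ e : Equiv.Perm (Fin r × Bool), rename e (pairDiffSq r)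

theorem lower_pairDiffSq (r : ℕ) : lower (Fin r × Bool) (pairDiffSq r) = 0 := by
  refine Finset.prod_induction _ (fun f => lower (Fin r × Bool) f = 0) ?_ ?_ ?_
  · intro f g hf hg
    rw [Derivation.leibniz, hf, hg, smul_zero, smul_zero, add_zero]
  · exact Derivation.map_one_eq_zero _
  · intro i _
    rw [Derivation.leibniz_pow, map_sub, lower_X, lower_X, sub_self, smul_zero, smul_zero]

theorem isHomogeneous_pairDiffSq (r : ℕ) : (pairDiffSq r).IsHomogeneous (2 * r) := by
  have h := IsHomogeneous.prod Finset.univ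
    (fun i : Fin r => (X (i, true) - X (i, false) : MvPolynomial (Fin r × Bool) ℚ) ^ 2)
    (fun _ => 1 * 2) fun i _ => ((isHomogeneous_X ℚ _).sub (isHomogeneous_X ℚ _)).pow 2
  have hsum : ∑ _i : Fin r, 1 * 2 = 2 * r := by simp [mul_comm]
  rwa [hsum] at h

theorem degreeOf_pairDiffSq_le (r : ℕ) (j : Fin r × Bool) :
    degreeOf j (pairDiffSq r) ≤ 2 := by
  have key : ∀ i : Fin r, degreeOf j
      ((X (i, true) - X (i, false) : MvPolynomial (Fin r × Bool) ℚ) ^ 2) ≤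
        if i = j.1 then 2 else 0 := by
    intro i
    refine (degreeOf_pow_le _ _ _).trans ?_
    have h := degreeOf_sub_le j (X (i, true) : MvPolynomial (Fin r × Bool) ℚ) (X (i, false))
    rw [degreeOf_X, degreeOf_X] at h
    obtain ⟨j, b⟩ := j
    by_cases hij : i = j
    · subst hij
      rw [if_pos rfl]
      have : max (if (i, b) = (i, true) then 1 else 0) (if (i, b) = (i, false) then 1 else 0) ≤ 1 :=
        max_le (by split_ifs <;> omega) (by split_ifs <;> omega)
      omega
    · have hji : ∀ b', (j, b) ≠ (i, b') := fun b' h => hij (Prod.ext_iff.1 h).1.symm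
      rw [if_neg (hji _), if_neg (hji _)] at h
      rw [if_neg hij]
      simpa using h
  calc degreeOf j (pairDiffSq r)
      ≤ ∑ i : Fin r, _ := degreeOf_prod_le _ _ _
    _ ≤ ∑ i : Fin r, if i = j.1 then 2 else 0 := Finset.sum_le_sum fun i _ => key i
    _ = 2 := by simp

theorem lower_symPairDiffSq (r : ℕ) : lower (Fin r × Bool) (symPairDiffSq r) = 0 := by
  rw [symPairDiffSq, map_sum]
  exact Finset.sum_eq_zero fun e _ => by rw [lower_rename, lower_pairDiffSq, map_zero]

theorem symPairDiffSq_mem (r : ℕ) : symPairDiffSq r ∈ boxSymmetric (Fin r × Bool) 2 (2 * r) := by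
  refine mem_boxSymmetric.2 ⟨fun e => ?_, ?_, fun d hd => ?_⟩
  · rw [symPairDiffSq, map_sum]
    simp only [rename_rename]
    exact Equiv.sum_comp (Equiv.mulLeft e) fun e' => rename e' (pairDiffSq r)
  · exact IsHomogeneous.sum _ _ _ fun e _ => (isHomogeneous_pairDiffSq r).rename_isHomogeneous
  · rw [symPairDiffSq, coeff_sum] at hd
    obtain ⟨e, -, he⟩ := Finset.exists_ne_zero_of_sum_ne_zero hd
    obtain ⟨u, rfl, hu⟩ := coeff_rename_ne_zero _ _ _ he
    intro i
    obtain ⟨j, rfl⟩ := e.surjective i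
    rw [Finsupp.mapDomain_apply e.injective]
    exact (monomial_le_degreeOf j (mem_support_iff.2 hu)).trans (degreeOf_pairDiffSq_le r j)

/-- At `x_i = 1`, `y_i = 0` every summand of the symmetrization is a square, and the one of the
identity permutation is `1`. -/
theorem symPairDiffSq_ne_zero (r : ℕ) : symPairDiffSq r ≠ 0 := by
  intro h
  let v : Fin r × Bool → ℚ := fun p => if p.2 then 1 else 0
  have h0 : eval v (symPairDiffSq r) = 0 := by rw [h, map_zero]
  have hnn : ∀ e : Equiv.Perm (Fin r × Bool), 0 ≤ eval v (rename e (pairDiffSq r)) := by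
    intro e
    rw [pairDiffSq, map_prod, map_prod]
    refine Finset.prod_nonneg fun i _ => ?_
    rw [map_pow, map_pow]
    exact sq_nonneg _
  rw [symPairDiffSq, map_sum, Finset.sum_eq_zero_iff_of_nonneg fun e _ => hnn e] at h0
  have h1 := h0 (Equiv.refl _) (Finset.mem_univ _)
  simp [pairDiffSq, v] at h1

end MvPolynomial

open MvPolynomial in
/-- The constant `1` is a highest weight vector for `ℓ = 1`. -/
theorem gaussCoeff_sub_le_succ {ℓ m k : ℕ} (hk : 2 * k < (ℓ + 1) * m) :
    gaussCoeff ℓ m (k + 1) - gaussCoeff ℓ m k ≤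
      gaussCoeff (ℓ + 1) m (k + 1) - gaussCoeff (ℓ + 1) m k := by
  have h1 : (1 : MvPolynomial (Fin m) ℚ) ∈ boxSymmetric (Fin m) 1 0 := by
    classical
    refine mem_boxSymmetric.2 ⟨IsSymmetric.one, isHomogeneous_one _ _, fun d hd i => ?_⟩
    rw [MvPolynomial.coeff_one] at hd
    split_ifs at hd with h
    · rw [← h]
      exact Nat.zero_le 1
    · exact absurd rfl hd
  have := gaussCoeff_sub_le_of_lower_eq_zero (ℓ := ℓ) (k := k) h1 one_ne_zero
    (Derivation.map_one_eq_zero _) (by simpa using hk)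
  simpa using this

theorem gaussCoeff_sub_le_of_le {ℓ ℓ' m k : ℕ} (hℓ : ℓ ≤ ℓ') (hk : 2 * k < ℓ * m) :
    gaussCoeff ℓ m (k + 1) - gaussCoeff ℓ m k ≤
      gaussCoeff ℓ' m (k + 1) - gaussCoeff ℓ' m k := by
  induction ℓ', hℓ using Nat.le_induction with
  | base => exact le_rfl
  | succ ℓ' h ih =>
    exact ih.trans (gaussCoeff_sub_le_succ
      (hk.trans_le (Nat.mul_le_mul_right m (h.trans (Nat.le_succ _)))))

open MvPolynomial in
/-- Multiplication by the invariant of `Sym^m (Sym² ℚ²)`, which exists for even `m` only. -/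
theorem gaussCoeff_sub_le_add_two {ℓ m k : ℕ} (hm : Even m) (hk : 2 * (k + m) < (ℓ + 2) * m) :
    gaussCoeff ℓ m (k + 1) - gaussCoeff ℓ m k ≤
      gaussCoeff (ℓ + 2) m (k + m + 1) - gaussCoeff (ℓ + 2) m (k + m) := by
  obtain ⟨r, rfl⟩ := hm.exists_two_nsmul
  have hcard : Fintype.card (Fin r × Bool) = 2 * r := by simp [mul_comm]
  have := gaussCoeff_sub_le_of_lower_eq_zero (ℓ := ℓ) (k := k) (symPairDiffSq_mem r)
    (symPairDiffSq_ne_zero r) (lower_symPairDiffSq r) (by rw [hcard]; simpa using hk)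
  rw [hcard] at this
  simpa using this

/-! ### Strict unimodality -/

theorem IsDStrictlyUnimodal.symm {d ℓ m : ℕ} (h : IsDStrictlyUnimodal d ℓ m) :
    IsDStrictlyUnimodal d m ℓ := by
  intro k h1 h2
  have := h k h1 (by rwa [mul_comm])
  unfold gaussCoeff at *
  rwa [gaussPoly_comm m ℓ]

/-- Partitions are compositions up to order. -/
theorem numPartitions_le (k : ℕ) : numPartitions k ≤ 2 ^ (k - 1) := by
  rw [← composition_card]
  exact Fintype.card_le_of_surjective _ Nat.Partition.ofComposition_surj

theorem numPartitions_pos (k : ℕ) : 0 < numPartitions k :=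
  Fintype.card_pos_iff.2 ⟨Nat.Partition.indiscrete k⟩

theorem two_le_thresholdL {d : ℕ} (hd : 2 ≤ d) : 2 ≤ thresholdL d := by
  classical
  have h := Nat.find_spec (exists_numPartitions_diff d)
  unfold thresholdL
  have h1 : numPartitions 1 ≤ 1 := numPartitions_le 1
  have h2 : numPartitions 2 ≤ 2 := numPartitions_le 2
  have p0 := numPartitions_pos 0
  have p1 := numPartitions_pos 1
  rw [Nat.le_find_iff]
  intro k hk
  interval_cases k
  · rw [zero_add]; omega
  · rw [one_add_one_eq_two]; omega

/-- The induction on odd `ℓ` in steps of two, starting at `ℓ = n - 1`. -/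
theorem isDStrictlyUnimodal_of_even {d n : ℕ} (hn : thresholdL d < n) (hn4 : 4 ≤ n)
    (hn_even : Even n)
    (h_base : ∀ ℓ : ℕ, n ≤ ℓ → IsDStrictlyUnimodal d ℓ n)
    (h_base_pred : ∀ ℓ : ℕ, n - 1 ≤ ℓ → IsDStrictlyUnimodal d ℓ (n - 1))
    {m : ℕ} (hm : Even m) (hnm : n < m) (ℓ : ℕ) (hℓ : Odd ℓ) (hnℓ : n - 1 ≤ ℓ) :
    IsDStrictlyUnimodal d ℓ m := by
  induction ℓ using Nat.strong_induction_on with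
  | _ ℓ ih =>
  rcases hnℓ.eq_or_lt with rfl | hlt
  · exact (h_base_pred m (by omega)).symm
  have hℓn : n + 1 ≤ ℓ := by
    obtain ⟨a, rfl⟩ := hℓ
    obtain ⟨b, rfl⟩ := hn_even
    omega
  obtain ⟨ℓ, rfl⟩ : ∃ ℓ', ℓ = ℓ' + 2 := ⟨ℓ - 2, by omega⟩
  intro k hk1 hk2
  by_cases hk : 2 * k < n * m
  · refine le_trans ((h_base m hnm.le).symm k hk1 ?_) (gaussCoeff_sub_le_of_le (by omega) hk)
    obtain ⟨r, rfl⟩ := hm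
    rw [← mul_two, ← mul_assoc] at hk ⊢
    omega
  -- Here `k ≥ 2 * m ≥ thresholdL d + m`, so `k - m` is in the range of the box `ℓ × m`.
  · have h4 : 4 * m ≤ n * m := Nat.mul_le_mul_right m hn4
    obtain ⟨j, rfl⟩ : ∃ j, k = j + m := ⟨k - m, by omega⟩
    have hj : j < ℓ * m / 2 := by
      rw [add_mul] at hk2
      omega
    refine le_trans (ih ℓ (by omega) ?_ (by omega) j (by omega) hj)
      (gaussCoeff_sub_le_add_two hm (by omega))
    simpa [Nat.odd_add, parity_simps] using hℓ

theorem theorem3p2 (d n : ℕ) (hd : 2 ≤ d) (hn_pos : 0 < n) (hn_even : Even n)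
    (hn : thresholdL d < n)
    (h_base : ∀ ℓ : ℕ, n ≤ ℓ → IsDStrictlyUnimodal d ℓ n)
    (h_base_pred : ∀ ℓ : ℕ, n - 1 ≤ ℓ → IsDStrictlyUnimodal d ℓ (n - 1)) :
    ∀ ℓ m : ℕ, n < ℓ → n < m → Odd (ℓ + m) → IsDStrictlyUnimodal d ℓ m := by
  intro ℓ m hℓ hm hodd
  have hn4 : 4 ≤ n := by
    have := two_le_thresholdL hd
    obtain ⟨b, rfl⟩ := hn_even
    omega
  rcases Nat.even_or_odd m with h | h
  · exact isDStrictlyUnimodal_of_even hn hn4 hn_even h_base h_base_pred h hm ℓ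
      (by rwa [Nat.odd_add, iff_true_right h] at hodd) (by omega)
  · exact (isDStrictlyUnimodal_of_even hn hn4 hn_even h_base h_base_pred
      (by rwa [Nat.odd_add', iff_true_left h] at hodd) hℓ m h (by omega)).symm
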